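/- Let $H$ be a separable complex Hilbert space and $K$ a complex Hilbert space. A normal channel $\Phi:\mathcal L(K)\to\mathcal L(H)$ is a unital, completely positive, normal linear map. Let $\rho_0$ be a density operator on $H$ (positive, trace class, trace one) defining a faithful state, and let $\Omega\in H\otimes H$ be a minimal GNS vector for $\rho_0$, where $\mathcal L(H)$ acts on $H\otimes H$ by $A\mapsto A\otimes 1$; that is, $\operatorname{tr}(\rho_0A)=\langle\Omega,(A\otimes 1)\Omega\rangle$ for all $A\in\mathcal L(H)$ and $\{(A\otimes 1)\Omega : A\in\mathcal L(H)\}$ is dense in $H\otimes H$. Let $\Omega^{\flat}=U_{\rm SWAP}\Omega$, where $U_{\rm SWAP}(x\otimes y)=y\otimes x$, and let $\rho_0'(A')=\langle\Omega,(1\otimes A')\Omega\rangle$ be the state that $\Omega$ induces on the commutant $1\otimes\mathcal L(H)\simeq\mathcal L(H)$. The Choi state of a normal channel $\Phi$ is the density operator $S_\Omega^\Phi$ on $H\otimes K$ with $$\operatorname{tr}\big(S_\Omega^\Phi(A'\otimes B)\big)=\langle\Omega,(\Phi(B)\otimes A')\Omega\rangle\qquad(A'\in\mathcal L(H),\ B\in\mathcal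 L(K)).$$ A family $\{K_\lambda\}_{\lambda\in L}$ ($L\ne\emptyset$) of bounded operators $H\to K$ is a Kraus decomposition of $\Phi$ if $\Phi(B)=\sum_\lambda K_\lambda^*BK_\lambda$ weakly for all $B\in\mathcal L(K)$; it is minimal if moreover it is weakly independent, i.e. for $(\alpha_\lambda)$ with $\sum_\lambda|\alpha_\lambda|^2<\infty$, if $\sum_\lambda\alpha_\lambda\langle\psi,K_\lambda\varphi\rangle=0$ for all $\varphi\in H$, $\psi\in K$, then all $\alpha_\lambda=0$. (a) Let $\Phi$ be a normal channel with a Kraus decomposition $\{K_\lambda\}_{\lambda\in L}$ such that $\operatorname{tr}(\rho_0K_\lambda^*K_{\lambda'})=0$ whenever $\lambda\neq\lambda'$, and put $w_\lambda=(1\otimes K_\lambda)\Omega^\flat$. Then the vectors $w_\lambda$ are pairwise orthogonal, the Choi state $S_\Omega^\Phi$ exists and is unique, and $S_\Omega^\Phi=\sum_{\lambda\in L}|w_\lambda\rangle\langle w_\lambda|$ (convergence in operator norm). (b) Let $S$ be a density operator on $H\otimes K$ whose partial trace over $K$ is the state $\rho_0'$, i.e. $\operatorname{tr}(S(A'\otimes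 1))=\rho_0'(A')$ for all $A'\in\mathcal L(H)$. Then there is a unique normal channel $\Phi$ with $S=S_\Omega^\Phi$. For every decomposition $S=\sum_{\lambda\in L}|w_\lambda\rangle\langle w_\lambda|$ (weakly convergent, $L\neq\emptyset$) into pairwise orthogonal nonzero vectors $w_\lambda\in H\otimes K$, there is a minimal Kraus decomposition $\{K_\lambda\}_{\lambda\in L}$ of $\Phi$ such that $\operatorname{tr}(\rho_0K_\lambda^*K_{\lambda'})=0$ whenever $\lambda\neq\lambda'$ and $w_\lambda=(1\otimes K_\lambda)\Omega^\flat$ for all $\lambda\in L$. Moreover, if $\Omega=\sum_i\sqrt{t_i}\,e_i\otimes e_i$ for an orthonormal basis $(e_i)$ of $H$ with $\rho_0e_i=t_ie_i$, then $\Omega^\flat=\Omega$ and $\rho_0'(A)=\operatorname{tr}(\rho_0A)$ for all $A$, so that $w_\lambda=(1\otimes K_\lambda)\Omega$ in (a) and (b), and the condition on $S$ in (b) is $\operatorname{tr}_K[S]=\rho_0$. -/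

import Mathlib

open scoped TensorProduct InnerProductSpace InnerProduct

namespace Choi

universe u v w

section Tensor

variable (H : Type u) (K : Type v) [NormedAddCommGroup H] [InnerProductSpace ℂ H]
  [NormedAddCommGroup K] [InnerProductSpace ℂ K]

/-- The Hilbert space tensor product: the completion of the algebraic tensor product with respect
to the inner product `⟪x ⊗ y, x' ⊗ y'⟫ = ⟪x, x'⟫ * ⟪y, y'⟫`. -/
abbrev HilbertTensor : Type (max u v) := UniformSpace.Completion (H ⊗[ℂ] K)

variable {H K}

/-- The elementary tensor `x ⊗ y`. -/
noncomputable def tmul (x : H) (y : K) : HilbertTensor H K :=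
  ((x ⊗ₜ[ℂ] y : H ⊗[ℂ] K) : UniformSpace.Completion (H ⊗[ℂ] K))

variable {H' : Type*} {K' : Type*} [NormedAddCommGroup H'] [InnerProductSpace ℂ H']
  [NormedAddCommGroup K'] [InnerProductSpace ℂ K']

/-- The bounded operator `A ⊗ B` on the Hilbert space tensor product. -/
noncomputable def opTensor (A : H →L[ℂ] H') (B : K →L[ℂ] K') :
    HilbertTensor H K →L[ℂ] HilbertTensor H' K' :=
  (TensorProduct.mapL A B).completion

/-- The swap `x ⊗ y ↦ y ⊗ x`. -/
noncomputable def swap : HilbertTensor H K →L[ℂ] HilbertTensor K H :=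
  ((TensorProduct.commIsometry ℂ H K).toContinuousLinearEquiv :
    H ⊗[ℂ] K →L[ℂ] K ⊗[ℂ] H).completion

@[simp] theorem opTensor_tmul (A : H →L[ℂ] H') (B : K →L[ℂ] K') (x : H) (y : K) :
    opTensor A B (tmul x y) = tmul (A x) (B y) := by
  simp [opTensor, tmul, ContinuousLinearMap.completion_apply_coe]

@[simp] theorem swap_tmul (x : H) (y : K) : swap (tmul x y) = tmul y x := by
  simp [swap, tmul, ContinuousLinearMap.completion_apply_coe]

end Tensor

section Sums

variable {E : Type u} {F : Type v} [NormedAddCommGroup E] [InnerProductSpace ℂ E]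
  [NormedAddCommGroup F] [InnerProductSpace ℂ F]

/-- `∑ l, T l = S`, the (unordered) series converging in the weak operator topology. -/
def HasWeakSum {L : Type w} (T : L → E →L[ℂ] F) (S : E →L[ℂ] F) : Prop :=
  ∀ (x : E) (y : F), HasSum (fun l => ⟪y, T l x⟫_ℂ) ⟪y, S x⟫_ℂ

/-- `T` is a trace-class operator with trace `c`: in every orthonormal basis the series of diagonal
elements converges (unconditionally, i.e. absolutely) to `c`. -/
def HasTrace (T : E →L[ℂ] E) (c : ℂ) : Prop :=
  ∀ (s : Set E) (b : HilbertBasis s ℂ E), HasSum (fun i => ⟪b i, T (b i)⟫_ℂ) c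

/-- Density operators, i.e. (normal) states: positive trace-class operators of trace one. -/
def IsDensityOperator (ρ : E →L[ℂ] E) : Prop :=
  ρ.IsPositive ∧ HasTrace ρ 1

/-- The state `A ↦ tr(ρ A)` is faithful: it vanishes on no nonzero positive operator. -/
def IsFaithfulState (ρ : E →L[ℂ] E) : Prop :=
  IsDensityOperator ρ ∧
    ∀ A : E →L[ℂ] E, A.IsPositive → HasTrace (ρ ∘L A) 0 → A = 0

/-- The rank-one operator `|x⟩⟨x|`. -/
noncomputable def ketBra (x : E) : E →L[ℂ] E := InnerProductSpace.rankOne ℂ x x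

end Sums

section Channels

variable {H : Type u} {K : Type v} [NormedAddCommGroup H] [InnerProductSpace ℂ H] [CompleteSpace H]
  [NormedAddCommGroup K] [InnerProductSpace ℂ K] [CompleteSpace K]

/-- Complete positivity: `∑ i j, a i * Φ (b i * b j) a j ≥ 0` (the left factors adjoined). -/
def IsCompletelyPositive (Φ : (K →L[ℂ] K) →ₗ[ℂ] (H →L[ℂ] H)) : Prop :=
  ∀ (n : ℕ) (a : Fin n → H →L[ℂ] H) (b : Fin n → K →L[ℂ] K),
    (∑ i, ∑ j, (a i)† ∘L Φ ((b i)† ∘L b j) ∘L a j).IsPositive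

/-- Normality: `Φ` preserves suprema of bounded upward directed families of self-adjoint
operators. -/
def IsNormalMap (Φ : (K →L[ℂ] K) →ₗ[ℂ] (H →L[ℂ] H)) : Prop :=
  ∀ (s : Set (K →L[ℂ] K)) (b : K →L[ℂ] K), s.Nonempty → DirectedOn (· ≤ ·) s →
    (∀ c ∈ s, IsSelfAdjoint c) → IsLUB s b → IsLUB (Φ '' s) (Φ b)

/-- Normal channels `L(K) → L(H)` (Heisenberg picture). -/
structure IsNormalChannel (Φ : (K →L[ℂ] K) →ₗ[ℂ] (H →L[ℂ] H)) : Prop where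
  completelyPositive : IsCompletelyPositive Φ
  unital : Φ (ContinuousLinearMap.id ℂ K) = ContinuousLinearMap.id ℂ H
  normal : IsNormalMap Φ

/-- `V` is a family of Kraus operators for `Φ`: `Φ B = ∑ l, (V l)† B (V l)` weakly. -/
def IsKrausDecomposition {L : Type w} (Φ : (K →L[ℂ] K) →ₗ[ℂ] (H →L[ℂ] H))
    (V : L → H →L[ℂ] K) : Prop :=
  ∀ B : K →L[ℂ] K, HasWeakSum (fun l => (V l)† ∘L B ∘L V l) (Φ B)

/-- Weak independence of a family of operators. -/
def WeaklyIndependent {L : Type w} (V : L → H →L[ℂ] K) : Prop :=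
  (∀ x : H, Summable fun l => ‖V l x‖ ^ 2) ∧
    ∀ α : L → ℂ, (Summable fun l => ‖α l‖ ^ 2) →
      (∀ (x : H) (y : K), HasSum (fun l => α l * ⟪y, V l x⟫_ℂ) 0) → ∀ l, α l = 0

/-- A minimal set of Kraus operators for `Φ`. -/
def IsMinimalKraus {L : Type w} (Φ : (K →L[ℂ] K) →ₗ[ℂ] (H →L[ℂ] H))
    (V : L → H →L[ℂ] K) : Prop :=
  IsKrausDecomposition Φ V ∧ WeaklyIndependent V

/-- `Ω` is a minimal GNS vector for `ρ₀` in `H ⊗ H`, on which `A ∈ L(H)` acts as `A ⊗ 1`: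
`tr(ρ₀ A) = ⟪Ω, (A ⊗ 1) Ω⟫` for all `A`, and `Ω` is cyclic. -/
def IsMinimalGNSVector (ρ₀ : H →L[ℂ] H) (Ω : HilbertTensor H H) : Prop :=
  (∀ A : H →L[ℂ] H,
    HasTrace (ρ₀ ∘L A) ⟪Ω, opTensor A (ContinuousLinearMap.id ℂ H) Ω⟫_ℂ) ∧
  DenseRange fun A : H →L[ℂ] H => opTensor A (ContinuousLinearMap.id ℂ H) Ω

/-- The value `⟪Ω, (1 ⊗ A') Ω⟫` at `A'` of the state which `Ω` induces on the commutant
`1 ⊗ L(H)` of `L(H) ⊗ 1`. -/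
noncomputable def commutantState (Ω : HilbertTensor H H) (A' : H →L[ℂ] H) : ℂ :=
  ⟪Ω, opTensor (ContinuousLinearMap.id ℂ H) A' Ω⟫_ℂ

/-- `S` is the Choi state of `Φ` associated with `Ω`: the density operator on `H ⊗ K` with
`tr(S (A' ⊗ B)) = ⟪Ω, (Φ B ⊗ A') Ω⟫` for all `A'` and `B`. -/
def IsChoiState (Ω : HilbertTensor H H) (Φ : (K →L[ℂ] K) →ₗ[ℂ] (H →L[ℂ] H))
    (S : HilbertTensor H K →L[ℂ] HilbertTensor H K) : Prop :=
  IsDensityOperator S ∧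
    ∀ (A' : H →L[ℂ] H) (B : K →L[ℂ] K),
      HasTrace (S ∘L opTensor A' B) ⟪Ω, opTensor (Φ B) A' Ω⟫_ℂ

/-- The first margin of `S` (its partial trace over `K`) is the state `σ` of `L(H)`:
`tr(S (A' ⊗ 1)) = σ A'` for all `A'`. -/
def HasFirstMargin (S : HilbertTensor H K →L[ℂ] HilbertTensor H K)
    (σ : (H →L[ℂ] H) → ℂ) : Prop :=
  ∀ A' : H →L[ℂ] H, HasTrace (S ∘L opTensor A' (ContinuousLinearMap.id ℂ K)) (σ A')

end Channels

end Choi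

/-!
Everything is read off from slices: for `ξ ∈ H ⊗ K` and `x ∈ H` the slice `(⟨x| ⊗ 1) ξ ∈ K` satisfies
`⟪y, slice x ξ⟫ = ⟪x ⊗ y, ξ⟫`, a vector is determined by its slices, and
`slice x ((1 ⊗ V) ξ) = V (slice x ξ)`. Write `Ω♭ = swap Ω`. Faithfulness of `ρ₀` says exactly that the
slices of `Ω♭` are dense in `H` (`IsMinimalGNSVector.denseRange_sliceDual`). Testing the identity that
defines the Choi state on rank-one operators then shows that a channel is determined by its Choi
state (`IsChoiState.channel_unique`), and conversely (`IsChoiState.unique`).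

From Kraus operators to the Choi state: with `w l = (1 ⊗ V l) Ω♭` one has
`⟪w l, (A' ⊗ B) w l⟫ = ⟪Ω, ((V l)† B (V l) ⊗ A') Ω⟫`. Weak convergence of the Kraus series survives
tensoring with `A'` (`HasWeakSum.opTensor_right`, by uniform boundedness), so these numbers sum to
`⟪Ω, (Φ B ⊗ A') Ω⟫`, while they also sum to `tr(S (A' ⊗ B))` for `S = ∑ |w l⟩⟨w l|`
(`hasTrace_comp_of_hasWeakSum`). The case `A' = 1`, `B = 1` gives `∑ ‖w l‖² = 1`, whence norm
convergence of the series for `S`.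

From a state to Kraus operators (`exists_kraus_of_hasFirstMargin`): let `S = ∑ |w l⟩⟨w l|`. The margin
condition at `A' = |x⟩⟨x|` reads `∑ ‖slice x (w l)‖² = ‖slice x Ω♭‖²`. Hence
`slice x Ω♭ ↦ slice x (w l)` is a contraction on a dense subspace; it extends to `V l` with
`(1 ⊗ V l) Ω♭ = w l` and `∑ (V l)† (V l) = 1`. The `V l` are Kraus operators of a unital completely
positive map, which is normal because bounded increasing nets converge strongly to their supremum
(`tendsto_apply_of_isLUB`, Vigier's theorem) and the Kraus series is dominated. Existence of the
channel uses `S = √S √S = ∑ |√S b i⟩⟨√S b i|` for an orthonormal basis `b`; for an arbitrary orthogonal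
decomposition of `S`, uniqueness of the channel identifies the result with the given `Φ`.
-/

namespace Choi

universe u v

/-! ### Operators and slices on the Hilbert space tensor product -/

section TensorLemmas

variable {H : Type u} {K : Type v} [NormedAddCommGroup H] [InnerProductSpace ℂ H]
  [NormedAddCommGroup K] [InnerProductSpace ℂ K]
  {H' : Type*} {K' : Type*} [NormedAddCommGroup H'] [InnerProductSpace ℂ H']
  [NormedAddCommGroup K'] [InnerProductSpace ℂ K']
  {H'' : Type*} {K'' : Type*} [NormedAddCommGroup H''] [InnerProductSpace ℂ H'']
  [NormedAddCommGroup K''] [InnerProductSpace ℂ K'']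

@[simp] theorem inner_tmul_tmul (x x' : H) (y y' : K) :
    ⟪tmul x y, tmul x' y'⟫_ℂ = ⟪x, x'⟫_ℂ * ⟪y, y'⟫_ℂ := by
  simp [tmul, UniformSpace.Completion.inner_coe]

/-- The span of the elementary tensors is dense. -/
theorem clm_ext_tmul {E : Type*} [NormedAddCommGroup E] [NormedSpace ℂ E]
    {S T : HilbertTensor H K →L[ℂ] E} (h : ∀ x y, S (tmul x y) = T (tmul x y)) : S = T := by
  ext ξ
  induction ξ using UniformSpace.Completion.induction_on with
  | hp => exact isClosed_eq S.continuous T.continuous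
  | ih a =>
    induction a using TensorProduct.induction_on with
    | zero => change S 0 = T 0; simp
    | tmul x y => exact h x y
    | add a b ha hb => rw [UniformSpace.Completion.coe_add, map_add, map_add, ha, hb]

theorem ext_inner_tmul {ξ η : HilbertTensor H K}
    (h : ∀ x y, ⟪tmul x y, ξ⟫_ℂ = ⟪tmul x y, η⟫_ℂ) : ξ = η := by
  have : innerSL ℂ ξ = innerSL ℂ η := clm_ext_tmul fun x y => by
    rw [innerSL_apply_apply, innerSL_apply_apply, ← inner_conj_symm, h, inner_conj_symm]
  exact ext_inner_right ℂ fun ζ => congr($this ζ)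

theorem norm_opTensor_le (A : H →L[ℂ] H') (B : K →L[ℂ] K') :
    ‖opTensor A B‖ ≤ ‖A‖ * ‖B‖ := by
  refine ContinuousLinearMap.opNorm_le_bound _ (by positivity) fun ξ => ?_
  induction ξ using UniformSpace.Completion.induction_on with
  | hp => exact isClosed_le (by fun_prop) (by fun_prop)
  | ih a =>
    rw [opTensor, ContinuousLinearMap.completion_apply_coe, UniformSpace.Completion.norm_coe,
      UniformSpace.Completion.norm_coe]
    exact (TensorProduct.mapL A B).le_of_opNorm_le (TensorProduct.norm_mapL_le A B) a

theorem tmul_add (x : H) (y y' : K) : tmul x (y + y') = tmul x y + tmul x y' := by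
  rw [tmul, TensorProduct.tmul_add, UniformSpace.Completion.coe_add]; rfl

theorem add_tmul (x x' : H) (y : K) : tmul (x + x') y = tmul x y + tmul x' y := by
  rw [tmul, TensorProduct.add_tmul, UniformSpace.Completion.coe_add]; rfl

theorem tmul_smul (c : ℂ) (x : H) (y : K) : tmul x (c • y) = c • tmul x y := by
  simp [tmul]

theorem smul_tmul (c : ℂ) (x : H) (y : K) : tmul (c • x) y = c • tmul x y := by
  simp [tmul, ← TensorProduct.smul_tmul']

/-- For fixed second factor, `A ↦ A ⊗ B` as a linear map. -/
noncomputable def opTensorLeft (B : K →L[ℂ] K') :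
    (H →L[ℂ] H') →ₗ[ℂ] HilbertTensor H K →L[ℂ] HilbertTensor H' K' where
  toFun A := opTensor A B
  map_add' A A' := clm_ext_tmul fun x y => by simp [add_tmul]
  map_smul' c A := clm_ext_tmul fun x y => by simp [smul_tmul]

@[simp] theorem opTensorLeft_apply (A : H →L[ℂ] H') (B : K →L[ℂ] K') :
    opTensorLeft B A = opTensor A B := rfl

@[simp] theorem opTensor_id_id :
    opTensor (ContinuousLinearMap.id ℂ H) (ContinuousLinearMap.id ℂ K) =
      ContinuousLinearMap.id ℂ _ :=
  clm_ext_tmul fun x y => by simp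

theorem opTensor_comp_opTensor (A : H →L[ℂ] H') (B : K →L[ℂ] K') (A' : H' →L[ℂ] H'')
    (B' : K' →L[ℂ] K'') : opTensor A' B' ∘L opTensor A B = opTensor (A' ∘L A) (B' ∘L B) :=
  clm_ext_tmul fun x y => by simp

theorem opTensor_opTensor (A : H →L[ℂ] H') (B : K →L[ℂ] K') (A' : H' →L[ℂ] H'')
    (B' : K' →L[ℂ] K'') (ξ : HilbertTensor H K) :
    opTensor A' B' (opTensor A B ξ) = opTensor (A' ∘L A) (B' ∘L B) ξ := by
  rw [← opTensor_comp_opTensor]; rfl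

theorem swap_opTensor (A : H →L[ℂ] H') (B : K →L[ℂ] K') (ξ : HilbertTensor H K) :
    swap (opTensor A B ξ) = opTensor B A (swap ξ) := by
  have : swap ∘L opTensor A B = opTensor B A ∘L swap := clm_ext_tmul fun x y => by simp
  exact congr($this ξ)

@[simp] theorem swap_swap (ξ : HilbertTensor H K) : swap (swap ξ) = ξ := by
  have : (swap : HilbertTensor K H →L[ℂ] HilbertTensor H K) ∘L swap =
    ContinuousLinearMap.id ℂ _ := clm_ext_tmul fun x y => by simp
  exact congr($this ξ)

theorem adjoint_opTensor [CompleteSpace H] [CompleteSpace K] [CompleteSpace H'] [CompleteSpace K']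
    (A : H →L[ℂ] H') (B : K →L[ℂ] K') : (opTensor A B)† = opTensor (A†) (B†) := by
  refine clm_ext_tmul fun x y => ext_inner_tmul fun x' y' => ?_
  simp [ContinuousLinearMap.adjoint_inner_right]

theorem adjoint_swap : (swap : HilbertTensor H K →L[ℂ] HilbertTensor K H)† = swap := by
  refine clm_ext_tmul fun x y => ext_inner_tmul fun x' y' => ?_
  simp [ContinuousLinearMap.adjoint_inner_right, mul_comm]

theorem inner_swap_left (ξ : HilbertTensor H K) (η : HilbertTensor K H) :
    ⟪swap ξ, η⟫_ℂ = ⟪ξ, swap η⟫_ℂ := by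
  rw [← ContinuousLinearMap.adjoint_inner_right, adjoint_swap]

/-- `⟪Ω♭, (A ⊗ B) Ω♭⟫ = ⟪Ω, (B ⊗ A) Ω⟫` for `Ω♭ = swap Ω`. -/
theorem inner_swap_opTensor_swap (Ω : HilbertTensor H K) (A : K →L[ℂ] K) (B : H →L[ℂ] H) :
    ⟪swap Ω, opTensor A B (swap Ω)⟫_ℂ = ⟪Ω, opTensor B A Ω⟫_ℂ := by
  rw [inner_swap_left, swap_opTensor, swap_swap]

/-- The bounded operator `y ↦ x ⊗ y`. -/
noncomputable def tmulL (x : H) : K →L[ℂ] HilbertTensor H K :=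
  UniformSpace.Completion.toComplL ∘L TensorProduct.mkL ℂ H K x

@[simp] theorem tmulL_apply (x : H) (y : K) : tmulL x y = tmul x y := rfl

/-- The slice `(⟨x| ⊗ 1) ξ ∈ K` of a vector `ξ ∈ H ⊗ K` along `x ∈ H`. -/
noncomputable def slice [CompleteSpace K] (x : H) : HilbertTensor H K →L[ℂ] K := (tmulL x)†

theorem inner_slice [CompleteSpace K] (x : H) (y : K) (ξ : HilbertTensor H K) :
    ⟪y, slice x ξ⟫_ℂ = ⟪tmul x y, ξ⟫_ℂ := by
  rw [slice, ContinuousLinearMap.adjoint_inner_right, tmulL_apply]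

theorem slice_tmul [CompleteSpace K] (x x' : H) (y : K) :
    slice x (tmul x' y) = ⟪x, x'⟫_ℂ • y :=
  ext_inner_left ℂ fun z => by rw [inner_slice, inner_tmul_tmul, inner_smul_right]

/-- A vector is determined by its slices. -/
theorem ext_slice [CompleteSpace K] {ξ η : HilbertTensor H K}
    (h : ∀ x, slice x ξ = slice x η) : ξ = η :=
  ext_inner_tmul fun x y => by rw [← inner_slice, ← inner_slice, h]

theorem slice_opTensor_id [CompleteSpace K] [CompleteSpace K'] (x : H) (B : K →L[ℂ] K')
    (ξ : HilbertTensor H K) :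
    slice x (opTensor (ContinuousLinearMap.id ℂ H) B ξ) = B (slice x ξ) := by
  have : slice x ∘L opTensor (ContinuousLinearMap.id ℂ H) B = B ∘L slice x :=
    clm_ext_tmul fun x y => by simp [slice_tmul]
  exact congr($this ξ)

theorem opTensor_rankOne [CompleteSpace K] (x : H') (x' : H) (B : K →L[ℂ] K')
    (ξ : HilbertTensor H K) :
    opTensor (InnerProductSpace.rankOne ℂ x x') B ξ = tmul x (B (slice x' ξ)) := by
  have : opTensor (InnerProductSpace.rankOne ℂ x x') B = tmulL x ∘L B ∘L slice x' :=
    clm_ext_tmul fun x y => by simp [slice_tmul, smul_tmul]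
  exact congr($this ξ)

theorem inner_opTensor_rankOne [CompleteSpace K] (x x' : H) (B : K →L[ℂ] K)
    (ξ : HilbertTensor H K) :
    ⟪ξ, opTensor (InnerProductSpace.rankOne ℂ x x') B ξ⟫_ℂ = ⟪slice x ξ, B (slice x' ξ)⟫_ℂ := by
  rw [opTensor_rankOne, ← inner_conj_symm, ← inner_slice, inner_conj_symm]

theorem opTensor_rankOne_rankOne (x : H') (x' : H) (y : K') (y' : K) :
    opTensor (InnerProductSpace.rankOne ℂ x x') (InnerProductSpace.rankOne ℂ y y') =
      InnerProductSpace.rankOne ℂ (tmul x y) (tmul x' y') :=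
  clm_ext_tmul fun a b => by simp [smul_tmul, tmul_smul, smul_smul, mul_comm]

/-- The slices of `ξ` as a function of the functional `⟨x|` instead of the vector `x`; this makes them
complex linear rather than conjugate linear. -/
noncomputable def sliceDual [CompleteSpace H] [CompleteSpace K] (ξ : HilbertTensor H K) :
    StrongDual ℂ H →ₗ[ℂ] K where
  toFun φ := slice ((InnerProductSpace.toDual ℂ H).symm φ) ξ
  map_add' φ ψ := ext_inner_left ℂ fun y => by
    simp only [inner_add_right, inner_slice, map_add, add_tmul, inner_add_left]
  map_smul' c φ := ext_inner_left ℂ fun y => by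
    simp only [map_smulₛₗ, inner_slice, smul_tmul, inner_smul_left, inner_smul_right,
      RingHom.id_apply, RingHomCompTriple.comp_apply]

end TensorLemmas

/-! ### Sums of rank-one operators and their traces -/

section SumLemmas

open Filter Topology

variable {E : Type u} [NormedAddCommGroup E] [InnerProductSpace ℂ E]

theorem hasSum_congr_iff {α L : Type*} [AddCommMonoid α] [TopologicalSpace α] {f g : L → α}
    {a : α} (h : ∀ l, f l = g l) : HasSum f a ↔ HasSum g a := by
  rw [funext h]

/-- A complex limit of a series of nonnegative reals is a nonnegative real. -/
theorem exists_nonneg_of_hasSum_ofReal {L : Type*} {f : L → ℝ} (hf : ∀ l, 0 ≤ f l) {c : ℂ}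
    (h : HasSum (fun l => (f l : ℂ)) c) : ∃ r : ℝ, 0 ≤ r ∧ c = r ∧ HasSum f r := by
  have hre : HasSum f c.re := by simpa using Complex.hasSum_re h
  exact ⟨c.re, hre.nonneg hf, h.unique (Complex.hasSum_ofReal.2 hre), hre⟩

theorem isPositive_of_forall_exists_real {T : E →L[ℂ] E}
    (h : ∀ x, ∃ r : ℝ, 0 ≤ r ∧ ⟪x, T x⟫_ℂ = r) : T.IsPositive := by
  refine (ContinuousLinearMap.isPositive_iff_complex T).2 fun x => ?_
  obtain ⟨r, hr, hx⟩ := h x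
  have : ⟪T x, x⟫_ℂ = r := by rw [← inner_conj_symm, hx, Complex.conj_ofReal]
  simp [this, hr]

theorem isPositive_iff_inner_nonneg {T : E →L[ℂ] E} :
    T.IsPositive ↔ ∀ x, ∃ r : ℝ, 0 ≤ r ∧ ⟪x, T x⟫_ℂ = r :=
  ⟨fun h x => ⟨_, h.re_inner_nonneg_right x, by
    have := (ContinuousLinearMap.isPositive_iff_complex T).1 h x
    rw [← h.inner_left_eq_inner_right]; exact this.1.symm⟩, isPositive_of_forall_exists_real⟩

theorem hasSum_sq_norm_inner {ι : Type*} (b : HilbertBasis ι ℂ E) (x : E) :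
    HasSum (fun i => ‖⟪b i, x⟫_ℂ‖ ^ 2) (‖x‖ ^ 2) := by
  have h := b.hasSum_inner_mul_inner x x
  rw [inner_self_eq_norm_sq_to_K] at h
  rw [← Complex.hasSum_ofReal, Complex.ofReal_pow]
  refine (hasSum_congr_iff fun i => ?_).2 h
  rw [← inner_conj_symm x, ← Complex.normSq_eq_conj_mul_self, Complex.normSq_eq_norm_sq]

theorem HasTrace.unique [CompleteSpace E] {T : E →L[ℂ] E} {c c' : ℂ} (h : HasTrace T c)
    (h' : HasTrace T c') : c = c' := by
  obtain ⟨s, b, -⟩ := exists_hilbertBasis ℂ E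
  exact (h s b).unique (h' s b)

/-- `tr(S |x⟩⟨y|) = ⟪y, S x⟫`, in every orthonormal basis. -/
theorem hasTrace_comp_rankOne [CompleteSpace E] (S : E →L[ℂ] E) (x y : E) :
    HasTrace (S ∘L InnerProductSpace.rankOne ℂ x y) ⟪y, S x⟫_ℂ := by
  intro s b
  refine (hasSum_congr_iff fun i => ?_).2 (b.hasSum_inner_mul_inner y (S x))
  simp

theorem summable_sq_norm_clm {F : Type*} [NormedAddCommGroup F] [NormedSpace ℂ F]
    (C : E →L[ℂ] F) {L : Type*} {w : L → E} (hw : Summable fun l => ‖w l‖ ^ 2) :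
    Summable fun l => ‖C (w l)‖ ^ 2 := by
  refine .of_nonneg_of_le (fun _ => by positivity) (fun l => ?_) (hw.mul_left (‖C‖ ^ 2))
  rw [← mul_pow]
  gcongr
  exact C.le_opNorm _

theorem summable_mul_of_sq {L : Type*} {f g : L → ℂ} (hf : Summable fun l => ‖f l‖ ^ 2)
    (hg : Summable fun l => ‖g l‖ ^ 2) : Summable fun l => f l * g l := by
  refine .of_norm_bounded ((hf.add hg)) fun l => ?_
  rw [norm_mul]
  nlinarith [sq_nonneg (‖f l‖ - ‖g l‖), norm_nonneg (f l), norm_nonneg (g l)]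

/-- The double series over a square-summable family and an orthonormal basis that computes a trace
converges absolutely. -/
theorem summable_inner_mul_inner {ι L : Type*} (b : HilbertBasis ι ℂ E) {u w : L → E}
    (hu : Summable fun l => ‖u l‖ ^ 2) (hw : Summable fun l => ‖w l‖ ^ 2) :
    Summable fun p : L × ι => ⟪u p.1, b p.2⟫_ℂ * ⟪b p.2, w p.1⟫_ℂ := by
  have key : ∀ {w : L → E}, (Summable fun l => ‖w l‖ ^ 2) →
      Summable fun p : L × ι => ‖⟪b p.2, w p.1⟫_ℂ‖ ^ 2 := fun {w} hw => by
    refine (summable_prod_of_nonneg fun _ => by positivity).2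
      ⟨fun l => (hasSum_sq_norm_inner b (w l)).summable, ?_⟩
    simpa only [(hasSum_sq_norm_inner b _).tsum_eq] using hw
  refine summable_mul_of_sq ?_ (key hw)
  simpa only [norm_inner_symm] using key hu

/-- `tr(S C) = ∑ ⟪w l, C w l⟫` for `S = ∑ |w l⟩⟨w l|`. Absolute convergence of the double series
`∑ ⟪C† w l, b i⟫ ⟪b i, w l⟫` allows summing over the basis `b` or over `l` first. -/
theorem hasTrace_comp_of_hasWeakSum [CompleteSpace E] {L : Type*} {w : L → E} {S : E →L[ℂ] E}
    (hS : HasWeakSum (fun l => ketBra (w l)) S) (hw : Summable fun l => ‖w l‖ ^ 2)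
    (C : E →L[ℂ] E) {c : ℂ} (hc : HasSum (fun l => ⟪w l, C (w l)⟫_ℂ) c) :
    HasTrace (S ∘L C) c := by
  intro s b
  obtain ⟨d, hd⟩ := summable_inner_mul_inner b (summable_sq_norm_clm (C†) hw) hw
  have h1 := hd.prod_fiberwise fun l => b.hasSum_inner_mul_inner ((C†) (w l)) (w l)
  simp only [ContinuousLinearMap.adjoint_inner_left] at h1
  have hdc := h1.unique hc
  subst hdc
  have hd' := (Equiv.prodComm s L).hasSum_iff.2 hd
  refine hd'.prod_fiberwise fun i => ?_
  refine (hasSum_congr_iff fun l => ?_).1 (hS (C (b i)) (b i))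
  simp [ketBra, ContinuousLinearMap.adjoint_inner_left]

theorem hasWeakSum_inner_self {L : Type*} {w : L → E} {S : E →L[ℂ] E}
    (hS : HasWeakSum (fun l => ketBra (w l)) S) (x : E) :
    HasSum (fun l => ((‖⟪x, w l⟫_ℂ‖ ^ 2 : ℝ) : ℂ)) ⟪x, S x⟫_ℂ := by
  refine (hasSum_congr_iff fun l => ?_).2 (hS x x)
  simp only [ketBra, InnerProductSpace.rankOne_apply, inner_smul_right]
  rw [← inner_conj_symm (w l) x, ← Complex.normSq_eq_conj_mul_self, Complex.normSq_eq_norm_sq]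

theorem isPositive_of_hasWeakSum_ketBra [CompleteSpace E] {L : Type*} {w : L → E} {S : E →L[ℂ] E}
    (hS : HasWeakSum (fun l => ketBra (w l)) S) : S.IsPositive :=
  isPositive_of_forall_exists_real fun x => by
    obtain ⟨r, hr, h, -⟩ := exists_nonneg_of_hasSum_ofReal (fun _ => by positivity)
      (hasWeakSum_inner_self hS x)
    exact ⟨r, hr, h⟩

/-- Tonelli for the nonnegative double series `∑ |⟪b i, w l⟫|²`, whose sums over `l` are the diagonal
elements of `S` and whose sums over `i` are `‖w l‖²`. -/
theorem summable_of_hasWeakSum_hasTrace [CompleteSpace E] {L : Type*} {w : L → E} {S : E →L[ℂ] E}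
    (hS : HasWeakSum (fun l => ketBra (w l)) S) {c : ℂ} (hc : HasTrace S c) :
    Summable fun l => ‖w l‖ ^ 2 := by
  obtain ⟨s, b, -⟩ := exists_hilbertBasis ℂ E
  have hr := fun i => exists_nonneg_of_hasSum_ofReal (fun _ => by positivity)
      (hasWeakSum_inner_self hS (b i))
  choose r hr0 hrS hrsum using hr
  have h2 : Summable fun p : s × L => ‖⟪b p.1, w p.2⟫_ℂ‖ ^ 2 := by
    refine (summable_prod_of_nonneg fun _ => by positivity).2 ⟨fun i => (hrsum i).summable, ?_⟩
    simp only [(hrsum _).tsum_eq]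
    have := (hc s b).summable
    simp only [hrS] at this
    exact Complex.summable_ofReal.1 this
  have h3 := (Equiv.prodComm L s).summable_iff.2 h2
  have h4 := ((summable_prod_of_nonneg fun _ => by simp).1 h3).2
  convert h4 using 2 with l
  exact (hasSum_sq_norm_inner b (w l)).tsum_eq.symm

theorem summable_ketBra [CompleteSpace E] {L : Type*} {w : L → E}
    (hw : Summable fun l => ‖w l‖ ^ 2) : Summable fun l => ketBra (w l) := by
  refine .of_norm_bounded hw fun l => ?_
  rw [ketBra, InnerProductSpace.norm_rankOne, sq]

theorem HasWeakSum.of_hasSum {F : Type*} [NormedAddCommGroup F] [InnerProductSpace ℂ F]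
    {L : Type*} {T : L → E →L[ℂ] F} {S : E →L[ℂ] F} (h : HasSum T S) : HasWeakSum T S :=
  fun x y => (h.mapL (ContinuousLinearMap.apply ℂ F x)).mapL (innerSL ℂ y)

theorem HasWeakSum.unique {F : Type*} [NormedAddCommGroup F] [InnerProductSpace ℂ F]
    {L : Type*} {T : L → E →L[ℂ] F} {S S' : E →L[ℂ] F} (h : HasWeakSum T S)
    (h' : HasWeakSum T S') : S = S' := by
  ext x
  exact ext_inner_left ℂ fun y => (h x y).unique (h' x y)

/-- A square root of a positive operator exhibits it as a weak sum of rank-one operators. -/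
theorem exists_hasWeakSum_ketBra [CompleteSpace E] {S : E →L[ℂ] E} (hS : S.IsPositive) :
    ∃ (s : Set E) (w : s → E), HasWeakSum (fun l => ketBra (w l)) S := by
  obtain ⟨s, b, -⟩ := exists_hilbertBasis ℂ E
  have hS0 : 0 ≤ S := (ContinuousLinearMap.nonneg_iff_isPositive S).2 hS
  have hsq : CFC.sqrt S * CFC.sqrt S = S := CFC.sqrt_mul_sqrt_self S
  have hadj : (CFC.sqrt S)† = CFC.sqrt S :=
    ((ContinuousLinearMap.nonneg_iff_isPositive _).1 (CFC.sqrt_nonneg S)).isSelfAdjoint.adjoint_eq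
  refine ⟨s, fun i => CFC.sqrt S (b i), fun x y => ?_⟩
  have hin : ∀ u v, ⟪u, CFC.sqrt S v⟫_ℂ = ⟪CFC.sqrt S u, v⟫_ℂ := fun u v => by
    rw [← ContinuousLinearMap.adjoint_inner_left, hadj]
  have h := b.hasSum_inner_mul_inner (CFC.sqrt S y) (CFC.sqrt S x)
  rw [← hin, show CFC.sqrt S (CFC.sqrt S x) = S x from congr($hsq x)] at h
  refine (hasSum_congr_iff fun i => ?_).2 h
  simp only [ketBra, InnerProductSpace.rankOne_apply, inner_smul_right, hin]
  ring

end SumLemmas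

/-! ### Weakly convergent series and tensor products -/

section WeakSumTensor

open Filter Topology

variable {H : Type*} {K : Type*} [NormedAddCommGroup H] [InnerProductSpace ℂ H]
  [NormedAddCommGroup K] [InnerProductSpace ℂ K]
  {H' : Type*} {K' : Type*} [NormedAddCommGroup H'] [InnerProductSpace ℂ H']
  [NormedAddCommGroup K'] [InnerProductSpace ℂ K']

/-- The uniform boundedness principle, applied to vectors and then to operators. -/
theorem HasWeakSum.exists_norm_sum_le [CompleteSpace H] [CompleteSpace H'] {L : Type*}
    {T : L → H →L[ℂ] H'} {S : H →L[ℂ] H'} (h : HasWeakSum T S) :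
    ∃ C, ∀ F : Finset L, ‖∑ l ∈ F, T l‖ ≤ C := by
  refine banach_steinhaus fun x => ?_
  have := banach_steinhaus (g := fun F : Finset L => innerSL ℂ ((∑ l ∈ F, T l) x)) fun y => by
    refine ⟨∑' l, ‖⟪y, T l x⟫_ℂ‖, fun F => ?_⟩
    rw [innerSL_apply_apply, norm_inner_symm, sum_apply, inner_sum]
    exact (norm_sum_le _ _).trans ((h x y).summable.norm.sum_le_tsum F fun _ _ => norm_nonneg _)
  simpa only [innerSL_apply_norm] using this

/-- For a bounded family of functionals, convergence on elementary tensors is convergence. -/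
theorem tendsto_clm_of_tendsto_tmul {α : Type*} {𝓕 : Filter α}
    {f : α → HilbertTensor H K →L[ℂ] ℂ} {g : HilbertTensor H K →L[ℂ] ℂ} {C : ℝ}
    (hC : ∀ a, ‖f a‖ ≤ C) (h : ∀ x y, Tendsto (fun a => f a (tmul x y)) 𝓕 (𝓝 (g (tmul x y))))
    (ξ : HilbertTensor H K) : Tendsto (fun a => f a ξ) 𝓕 (𝓝 (g ξ)) := by
  have heq : Equicontinuous fun a => (f a : HilbertTensor H K → ℂ) :=
    by
    have h := (NormedSpace.equicontinuous_TFAE f).out 1 5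
    exact h.2 ⟨C, hC⟩
  induction ξ using UniformSpace.Completion.induction_on with
  | hp => exact heq.isClosed_setOfPred_tendsto g.continuous
  | ih a =>
    induction a using TensorProduct.induction_on with
    | zero =>
      change Tendsto (fun a => f a 0) 𝓕 (𝓝 (g 0))
      simpa using tendsto_const_nhds
    | tmul x y => exact h x y
    | add a b ha hb => simpa only [UniformSpace.Completion.coe_add, map_add] using ha.add hb

/-- Tensoring with a fixed operator preserves weak convergence of series: by the uniform boundedness
principle the partial sums are bounded, so convergence on elementary tensors suffices. -/
theorem HasWeakSum.opTensor_right [CompleteSpace H] [CompleteSpace H'] {L : Type*}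
    {T : L → H →L[ℂ] H'} {S : H →L[ℂ] H'} (h : HasWeakSum T S) (A : K →L[ℂ] K') :
    HasWeakSum (fun l => opTensor (T l) A) (opTensor S A) := by
  obtain ⟨C, hC⟩ := h.exists_norm_sum_le
  set G : Finset L → HilbertTensor H K →L[ℂ] HilbertTensor H' K' :=
    fun F => opTensor (∑ l ∈ F, T l) A with hG
  have hGC : ∀ F, ‖G F‖ ≤ C * ‖A‖ := fun F =>
    (norm_opTensor_le _ _).trans (by gcongr; exact hC F)
  suffices ∀ ξ η, Tendsto (fun F => ⟪η, G F ξ⟫_ℂ) atTop (𝓝 ⟪η, opTensor S A ξ⟫_ℂ) by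
    intro ξ η
    refine (this ξ η).congr fun F => ?_
    rw [hG]
    simp only [← opTensorLeft_apply, map_sum, sum_apply, inner_sum]
  have hbase : ∀ x y x' y', Tendsto (fun F => ⟪tmul x' y', G F (tmul x y)⟫_ℂ) atTop
      (𝓝 ⟪tmul x' y', opTensor S A (tmul x y)⟫_ℂ) := fun x y x' y' => by
    simp only [hG, opTensor_tmul, inner_tmul_tmul]
    refine Tendsto.mul_const _ ?_
    simpa only [sum_apply, inner_sum, HasSum, SummationFilter.unconditional_filter] using h x x'
  have hleft : ∀ ξ x' y', Tendsto (fun F => ⟪tmul x' y', G F ξ⟫_ℂ) atTop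
      (𝓝 ⟪tmul x' y', opTensor S A ξ⟫_ℂ) := fun ξ x' y' => by
    refine tendsto_clm_of_tendsto_tmul (f := fun F => innerSL ℂ (tmul x' y') ∘L G F)
      (g := innerSL ℂ (tmul x' y') ∘L opTensor S A) (C := ‖tmul x' y'‖ * (C * ‖A‖)) (fun F => ?_)
      (fun x y => hbase x y x' y') ξ
    refine (ContinuousLinearMap.opNorm_comp_le _ _).trans ?_
    rw [innerSL_apply_norm]
    gcongr
    exact hGC F
  intro ξ η
  -- The inner product is conjugate linear in `η`, so the extension to all `η` is made for its conjugate.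
  have hconj := tendsto_clm_of_tendsto_tmul (f := fun F => innerSL ℂ (G F ξ)) (𝓕 := atTop)
      (g := innerSL ℂ (opTensor S A ξ)) (C := C * ‖A‖ * ‖ξ‖) (fun F => ?_)
      (fun x' y' => ?_) η
  · simpa only [innerSL_apply_apply, Function.comp_def, inner_conj_symm] using
      (Complex.continuous_conj.tendsto _).comp hconj
  · rw [innerSL_apply_norm]
    exact (G F).le_of_opNorm_le (hGC F) ξ
  · simpa only [innerSL_apply_apply, Function.comp_def, inner_conj_symm] using
      (Complex.continuous_conj.tendsto _).comp (hleft ξ x' y')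

end WeakSumTensor

/-! ### Increasing nets of operators -/

section Monotone

open Filter Topology

variable {E : Type*} [NormedAddCommGroup E] [InnerProductSpace ℂ E] [CompleteSpace E]

/-- Factor `D = √D √D`; this turns convergence of quadratic forms into strong convergence. -/
theorem norm_sq_apply_le_of_isPositive {D : E →L[ℂ] E} (hD : D.IsPositive) (x : E) :
    ‖D x‖ ^ 2 ≤ ‖D‖ * (⟪x, D x⟫_ℂ).re := by
  have hD0 : 0 ≤ D := (ContinuousLinearMap.nonneg_iff_isPositive D).2 hD
  have hsq : CFC.sqrt D * CFC.sqrt D = D := CFC.sqrt_mul_sqrt_self D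
  have hadj : (CFC.sqrt D)† = CFC.sqrt D :=
    ((ContinuousLinearMap.nonneg_iff_isPositive _).1 (CFC.sqrt_nonneg D)).isSelfAdjoint.adjoint_eq
  have h1 : D x = CFC.sqrt D (CFC.sqrt D x) := congr($hsq.symm x)
  have h2 : (⟪x, D x⟫_ℂ).re = ‖CFC.sqrt D x‖ ^ 2 := by
    rw [h1, ← ContinuousLinearMap.adjoint_inner_left, hadj]
    exact inner_self_eq_norm_sq (𝕜 := ℂ) _
  have h3 : ‖CFC.sqrt D‖ ^ 2 = ‖D‖ := by
    rw [sq, ← ContinuousLinearMap.norm_adjoint_comp_self, hadj]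
    exact congr(‖$hsq‖)
  rw [h2, ← h3, ← mul_pow, h1]
  gcongr
  exact (CFC.sqrt D).le_opNorm _

omit [CompleteSpace E] in
open scoped ComplexOrder in
theorem isPositive_of_tendsto {α : Type*} {𝓕 : Filter α} [𝓕.NeBot] {D : α → E →L[ℂ] E}
    {T : E →L[ℂ] E} (hD : ∀ᶠ a in 𝓕, (D a).IsPositive)
    (h : ∀ x, Tendsto (fun a => ⟪x, D a x⟫_ℂ) 𝓕 (𝓝 ⟪x, T x⟫_ℂ)) : T.IsPositive := by
  refine isPositive_of_forall_exists_real fun x => ?_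
  have h0 : 0 ≤ ⟪x, T x⟫_ℂ := ge_of_tendsto (h x) (hD.mono fun a ha => ha.inner_nonneg_right x)
  obtain ⟨hre, him⟩ := Complex.le_def.1 h0
  exact ⟨_, hre, Complex.ext rfl (by simpa using him.symm)⟩

/-- Vigier's theorem: a bounded increasing net of operators converges strongly to its
supremum. -/
theorem tendsto_apply_of_isLUB {α : Type*} [Preorder α] [IsDirectedOrder α] [Nonempty α]
    {c : α → E →L[ℂ] E} (hc : Monotone c) {b : E →L[ℂ] E} (hb : IsLUB (Set.range c) b) (x : E) :
    Tendsto (fun a => c a x) atTop (𝓝 (b x)) := by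
  obtain ⟨a₀⟩ := ‹Nonempty α›
  have hcb : ∀ a, c a ≤ b := fun a => hb.1 ⟨a, rfl⟩
  -- All differences `c a' - c a` with `a₀ ≤ a ≤ a'` lie between `0` and `b - c a₀`.
  have hnorm : ∀ a a', a₀ ≤ a → a ≤ a' → ‖c a' - c a‖ ≤ ‖b - c a₀‖ := fun a a' h h' =>
    CStarAlgebra.norm_le_norm_of_nonneg_of_le (sub_nonneg.2 (hc h'))
      (sub_le_sub (hcb a') (hc h))
  have hre_mono : ∀ {S T : E →L[ℂ] E}, S ≤ T → ∀ x, (⟪x, S x⟫_ℂ).re ≤ (⟪x, T x⟫_ℂ).re := by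
    intro S T h x
    have := ((ContinuousLinearMap.le_def S T).1 h).re_inner_nonneg_right x
    simpa [inner_sub_right] using this
  have hlim : ∀ x, ∃ y, Tendsto (fun a => c a x) atTop (𝓝 y) := by
    intro x
    set q : α → ℝ := fun a => (⟪x, c a x⟫_ℂ).re
    have hq : Monotone q := fun a a' h => hre_mono (hc h) x
    have hqb : BddAbove (Set.range q) :=
      ⟨(⟪x, b x⟫_ℂ).re, by rintro _ ⟨a, rfl⟩; exact hre_mono (hcb a) x⟩
    refine cauchy_map_iff_exists_tendsto.1 (Metric.cauchy_iff.2 ⟨inferInstance, fun ε hε => ?_⟩)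
    set M := ‖b - c a₀‖ + 1 with hM
    have hM0 : 0 < M := by positivity
    have hδ : 0 < (ε / 2) ^ 2 / M := by positivity
    obtain ⟨N, hN, hN₀⟩ := (((tendsto_atTop_ciSup hq hqb).eventually_const_lt
      (sub_lt_self _ hδ)).and (eventually_ge_atTop a₀)).exists
    have hclose : ∀ a, N ≤ a → dist (c a x) (c N x) < ε / 2 := fun a ha => by
      rw [dist_eq_norm, ← sub_apply]
      refine lt_of_pow_lt_pow_left₀ 2 (by positivity) ?_
      have hpos : (c a - c N).IsPositive := hc ha
      calc ‖(c a - c N) x‖ ^ 2 ≤ ‖c a - c N‖ * (q a - q N) := by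
            simpa [inner_sub_right, q] using norm_sq_apply_le_of_isPositive hpos x
        _ ≤ M * (q a - q N) := by
            refine mul_le_mul_of_nonneg_right ?_ (sub_nonneg.2 (hq ha))
            linarith [hnorm N a hN₀ ha]
        _ < M * ((ε / 2) ^ 2 / M) := by
            gcongr
            linarith [le_ciSup hqb a]
        _ = (ε / 2) ^ 2 := by field_simp
    refine ⟨(fun a => c a x) '' Set.Ici N, image_mem_map (Ici_mem_atTop N), ?_⟩
    rintro _ ⟨a, ha, rfl⟩ _ ⟨a', ha', rfl⟩
    linarith [dist_triangle_right (c a x) (c a' x) (c N x), hclose a ha, hclose a' ha']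
  -- The strong limit is a bounded operator; it is sandwiched between the net and `b`, hence equals `b`.
  choose f hf using hlim
  have hbd : ∀ x, ‖f x‖ ≤ (‖c a₀‖ + ‖b - c a₀‖) * ‖x‖ := fun x => by
    refine le_of_tendsto (hf x).norm ((eventually_ge_atTop a₀).mono fun a ha => ?_)
    refine (c a).le_of_opNorm_le ?_ x
    calc ‖c a‖ = ‖c a₀ + (c a - c a₀)‖ := by rw [add_sub_cancel]
      _ ≤ _ := (norm_add_le _ _).trans (by gcongr; exact hnorm a₀ a le_rfl ha)
  let g : E →L[ℂ] E := (linearMapOfTendsto f (fun a => (c a : E →ₗ[ℂ] E))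
    (tendsto_pi_nhds.2 hf)).mkContinuous _ hbd
  have hg : ∀ x, Tendsto (fun a => c a x) atTop (𝓝 (g x)) := hf
  have hgb : g ≤ b := isPositive_of_tendsto (𝓕 := atTop) (D := fun a => b - c a)
    (.of_forall hcb) fun x => tendsto_const_nhds.inner ((hg x).const_sub (b x))
  have hbg : b ≤ g := hb.2 <| by
    rintro _ ⟨a, rfl⟩
    exact isPositive_of_tendsto (𝓕 := atTop) (D := fun a' => c a' - c a)
      ((eventually_ge_atTop a).mono fun a' h => hc h)
      fun x => tendsto_const_nhds.inner ((hg x).sub_const (c a x))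
  rw [le_antisymm hbg hgb]
  exact hg x

end Monotone

/-! ### Kraus decompositions and normal channels -/

section Kraus

open Filter Topology

variable {H : Type u} {K : Type v} [NormedAddCommGroup H] [InnerProductSpace ℂ H] [CompleteSpace H]
  [NormedAddCommGroup K] [InnerProductSpace ℂ K] [CompleteSpace K] {L : Type*}

/-- If `∑ (V l)† (V l) ≤ 1`, then the row `z ↦ ∑ (V l)† z l` is a contraction. -/
theorem norm_sum_adjoint_sq_le {V : L → H →L[ℂ] K}
    (hV : ∀ (F : Finset L) (x : H), ∑ l ∈ F, ‖V l x‖ ^ 2 ≤ ‖x‖ ^ 2) (F : Finset L) (z : L → K) :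
    ‖∑ l ∈ F, ((V l)†) (z l)‖ ^ 2 ≤ ∑ l ∈ F, ‖z l‖ ^ 2 := by
  set u := ∑ l ∈ F, ((V l)†) (z l) with hu
  have h1 : ‖u‖ ^ 2 ≤ ∑ l ∈ F, ‖V l u‖ * ‖z l‖ := by
    have : ((‖u‖ ^ 2 : ℝ) : ℂ) = ∑ l ∈ F, ⟪V l u, z l⟫_ℂ := by
      have h := inner_self_eq_norm_sq_to_K (𝕜 := ℂ) u
      nth_rw 2 [hu] at h
      simp only [inner_sum, ContinuousLinearMap.adjoint_inner_right] at h
      rw [h]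
      simp
    calc ‖u‖ ^ 2 = ‖((‖u‖ ^ 2 : ℝ) : ℂ)‖ := by simp
      _ ≤ _ := by
        rw [this]
        exact (norm_sum_le _ _).trans (Finset.sum_le_sum fun l _ => norm_inner_le_norm _ _)
  have h2 : (‖u‖ ^ 2) ^ 2 ≤ ‖u‖ ^ 2 * ∑ l ∈ F, ‖z l‖ ^ 2 :=
    calc (‖u‖ ^ 2) ^ 2 ≤ (∑ l ∈ F, ‖V l u‖ * ‖z l‖) ^ 2 := by gcongr
      _ ≤ (∑ l ∈ F, ‖V l u‖ ^ 2) * ∑ l ∈ F, ‖z l‖ ^ 2 := Finset.sum_mul_sq_le_sq_mul_sq _ _ _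
      _ ≤ _ := by gcongr; exact hV F u
  rcases (sq_nonneg ‖u‖).eq_or_lt with h | h
  · rw [← h]; positivity
  · rw [sq (‖u‖ ^ 2)] at h2
    exact le_of_mul_le_mul_left h2 h

theorem summable_adjoint_apply {V : L → H →L[ℂ] K}
    (hV : ∀ (F : Finset L) (x : H), ∑ l ∈ F, ‖V l x‖ ^ 2 ≤ ‖x‖ ^ 2) {z : L → K}
    (hz : Summable fun l => ‖z l‖ ^ 2) : Summable fun l => ((V l)†) (z l) := by
  refine summable_iff_vanishing_norm.2 fun ε hε => ?_
  obtain ⟨s, hs⟩ := summable_iff_vanishing_norm.1 hz (ε ^ 2) (by positivity)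
  refine ⟨s, fun t ht => lt_of_pow_lt_pow_left₀ 2 hε.le ?_⟩
  refine (norm_sum_adjoint_sq_le hV t z).trans_lt ((le_abs_self _).trans_lt ?_)
  simpa using hs t ht

/-- A family of operators with `∑ (V l)† (V l) ≤ 1` is a Kraus decomposition of some linear map:
the series `∑ (V l)† B (V l)` converges strongly. -/
theorem exists_isKrausDecomposition {V : L → H →L[ℂ] K}
    (hV : ∀ (F : Finset L) (x : H), ∑ l ∈ F, ‖V l x‖ ^ 2 ≤ ‖x‖ ^ 2) :
    ∃ Φ : (K →L[ℂ] K) →ₗ[ℂ] (H →L[ℂ] H), IsKrausDecomposition Φ V := by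
  have hsq : ∀ x, Summable fun l => ‖V l x‖ ^ 2 := fun x =>
    summable_of_sum_le (fun _ => by positivity) (fun F => hV F x)
  have hz : ∀ (B : K →L[ℂ] K) x, Summable fun l => ‖B (V l x)‖ ^ 2 := fun B x =>
    summable_sq_norm_clm B (hsq x)
  have hs : ∀ (B : K →L[ℂ] K) x, Summable fun l => ((V l)†) (B (V l x)) := fun B x =>
    summable_adjoint_apply hV (hz B x)
  have hbd : ∀ (B : K →L[ℂ] K) x, ‖∑' l, ((V l)†) (B (V l x))‖ ≤ ‖B‖ * ‖x‖ := fun B x => by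
    refine le_of_tendsto (hs B x).hasSum.norm (.of_forall fun F => ?_)
    refine le_of_sq_le_sq ?_ (by positivity)
    calc _ ≤ ∑ l ∈ F, ‖B (V l x)‖ ^ 2 := norm_sum_adjoint_sq_le hV F _
      _ ≤ ∑ l ∈ F, ‖B‖ ^ 2 * ‖V l x‖ ^ 2 := by
        gcongr with l
        rw [← mul_pow]
        gcongr
        exact B.le_opNorm _
      _ ≤ (‖B‖ * ‖x‖) ^ 2 := by
        rw [← Finset.mul_sum, mul_pow]
        gcongr
        exact hV F x
  let Ψ : (K →L[ℂ] K) → H →L[ℂ] H := fun B => LinearMap.mkContinuous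
    { toFun := fun x => ∑' l, ((V l)†) (B (V l x))
      map_add' := fun x y => by
        simp only [map_add]
        exact (hs B x).tsum_add (hs B y)
      map_smul' := fun c x => by
        simp only [map_smul, RingHom.id_apply]
        exact (hs B x).tsum_const_smul c } ‖B‖ (hbd B)
  have hΨ : ∀ B x, Ψ B x = ∑' l, ((V l)†) (B (V l x)) := fun _ _ => rfl
  refine ⟨⟨⟨Ψ, fun B C => ?_⟩, fun c B => ?_⟩, fun B x y => ?_⟩
  · ext x
    simp only [hΨ, add_apply, map_add]
    exact (hs B x).tsum_add (hs C x)
  · ext x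
    simp only [hΨ, smul_apply, map_smul, RingHom.id_apply]
    exact (hs B x).tsum_const_smul c
  · exact (hs B x).hasSum.mapL (innerSL ℂ y)

theorem IsKrausDecomposition.hasSum_inner {Φ : (K →L[ℂ] K) →ₗ[ℂ] (H →L[ℂ] H)}
    {V : L → H →L[ℂ] K} (h : IsKrausDecomposition Φ V) (B : K →L[ℂ] K) (x y : H) :
    HasSum (fun l => ⟪V l y, B (V l x)⟫_ℂ) ⟪y, Φ B x⟫_ℂ := by
  refine (hasSum_congr_iff fun l => ?_).1 (h B x y)
  simp [ContinuousLinearMap.adjoint_inner_right]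

theorem IsKrausDecomposition.summable_sq_norm {Φ : (K →L[ℂ] K) →ₗ[ℂ] (H →L[ℂ] H)}
    {V : L → H →L[ℂ] K} (h : IsKrausDecomposition Φ V) (x : H) :
    Summable fun l => ‖V l x‖ ^ 2 := by
  have := (h.hasSum_inner (.id ℂ K) x x).summable
  refine Complex.summable_ofReal.1 (this.congr fun l => ?_)
  simp [inner_self_eq_norm_sq_to_K]

theorem IsKrausDecomposition.isCompletelyPositive {Φ : (K →L[ℂ] K) →ₗ[ℂ] (H →L[ℂ] H)}
    {V : L → H →L[ℂ] K} (h : IsKrausDecomposition Φ V) : IsCompletelyPositive Φ := by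
  intro n a b
  refine isPositive_of_forall_exists_real fun x => ?_
  have hsum : HasSum (fun l => ∑ i, ∑ j, ⟪V l (a i x), ((b i)† ∘L b j) (V l (a j x))⟫_ℂ)
      (∑ i, ∑ j, ⟪a i x, Φ ((b i)† ∘L b j) (a j x)⟫_ℂ) :=
    hasSum_sum fun i _ => hasSum_sum fun j _ => h.hasSum_inner _ _ _
  have hterm : ∀ l, ∑ i, ∑ j, ⟪V l (a i x), ((b i)† ∘L b j) (V l (a j x))⟫_ℂ =
      ((‖∑ i, b i (V l (a i x))‖ ^ 2 : ℝ) : ℂ) := fun l => by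
    have := inner_self_eq_norm_sq_to_K (𝕜 := ℂ) (∑ i, b i (V l (a i x)))
    rw [sum_inner] at this
    simp only [inner_sum] at this
    simp only [ContinuousLinearMap.comp_apply, ContinuousLinearMap.adjoint_inner_right, this]
    simp
  obtain ⟨r, hr, hr', -⟩ := exists_nonneg_of_hasSum_ofReal (fun _ => by positivity)
    ((hasSum_congr_iff hterm).1 hsum)
  refine ⟨r, hr, ?_⟩
  rw [← hr']
  simp only [sum_apply, inner_sum, ContinuousLinearMap.comp_apply,
    ContinuousLinearMap.adjoint_inner_right]

theorem IsKrausDecomposition.isPositive_apply {Φ : (K →L[ℂ] K) →ₗ[ℂ] (H →L[ℂ] H)}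
    {V : L → H →L[ℂ] K} (h : IsKrausDecomposition Φ V) {B : K →L[ℂ] K} (hB : B.IsPositive) :
    (Φ B).IsPositive := by
  refine isPositive_of_forall_exists_real fun x => ?_
  choose r hr hr' using fun l => isPositive_iff_inner_nonneg.1 hB (V l x)
  obtain ⟨s, hs, hs', -⟩ := exists_nonneg_of_hasSum_ofReal hr
    ((hasSum_congr_iff hr').1 (h.hasSum_inner B x x))
  exact ⟨s, hs, hs'⟩

/-- A map with a Kraus decomposition is normal: Vigier's theorem gives strong convergence of the
net to its supremum, which passes to the Kraus series by dominated convergence. -/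
theorem IsKrausDecomposition.isNormalMap {Φ : (K →L[ℂ] K) →ₗ[ℂ] (H →L[ℂ] H)}
    {V : L → H →L[ℂ] K} (h : IsKrausDecomposition Φ V) : IsNormalMap Φ := by
  intro s b hne hdir _ hb
  have hmono : ∀ {B C : K →L[ℂ] K}, B ≤ C → Φ B ≤ Φ C := fun {B C} hBC => by
    rw [ContinuousLinearMap.le_def, ← map_sub]
    exact h.isPositive_apply hBC
  refine ⟨?_, fun T hT => ?_⟩
  · rintro _ ⟨c, hc, rfl⟩
    exact hmono (hb.1 hc)
  have : Nonempty s := hne.to_subtype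
  have : IsDirectedOrder s := ⟨hdir.directed_val⟩
  have hlim := tendsto_apply_of_isLUB (α := s) (c := Subtype.val) (fun _ _ h => h)
    (b := b) (by simpa using hb)
  obtain ⟨c₀⟩ := ‹Nonempty s›
  have hΦ : ∀ x, Tendsto (fun c : s => ⟪x, Φ c x⟫_ℂ) atTop (𝓝 ⟪x, Φ b x⟫_ℂ) := fun x => by
    simp only [← (h.hasSum_inner _ x x).tsum_eq]
    refine tendsto_tsum_of_dominated_convergence
      (bound := fun l => (‖b - (c₀ : K →L[ℂ] K)‖ + ‖b‖) * ‖V l x‖ ^ 2)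
      ((h.summable_sq_norm x).mul_left _)
      (fun l => tendsto_const_nhds.inner (hlim (V l x))) ?_
    filter_upwards [eventually_ge_atTop c₀] with c hc l
    -- The net itself may be unbounded in norm; its tail `c ≥ c₀` is bounded.
    have hc' : ‖(c : K →L[ℂ] K)‖ ≤ ‖b - (c₀ : K →L[ℂ] K)‖ + ‖b‖ := by
      have h1 : ‖b - (c : K →L[ℂ] K)‖ ≤ ‖b - (c₀ : K →L[ℂ] K)‖ :=
        CStarAlgebra.norm_le_norm_of_nonneg_of_le (sub_nonneg.2 (hb.1 c.2))
          (sub_le_sub_left (show (c₀ : K →L[ℂ] K) ≤ c from hc) b)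
      linarith [norm_sub_rev b (c : K →L[ℂ] K),
        norm_sub_norm_le (c : K →L[ℂ] K) b]
    calc ‖⟪V l x, (c : K →L[ℂ] K) (V l x)⟫_ℂ‖ ≤ ‖V l x‖ * ‖(c : K →L[ℂ] K) (V l x)‖ :=
          norm_inner_le_norm _ _
      _ ≤ ‖V l x‖ * ((‖b - (c₀ : K →L[ℂ] K)‖ + ‖b‖) * ‖V l x‖) := by
          gcongr
          exact (c : K →L[ℂ] K).le_of_opNorm_le hc' _
      _ = _ := by ring
  -- `T - Φ b` is the weak limit of the positive operators `T - Φ c`.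
  refine isPositive_of_tendsto (𝓕 := atTop) (D := fun c : s => T - Φ c)
    (.of_forall fun c => hT ⟨c, c.2, rfl⟩) fun x => ?_
  simp only [sub_apply, inner_sub_right]
  exact (hΦ x).const_sub _

theorem IsKrausDecomposition.isNormalChannel {Φ : (K →L[ℂ] K) →ₗ[ℂ] (H →L[ℂ] H)}
    {V : L → H →L[ℂ] K} (h : IsKrausDecomposition Φ V)
    (h1 : Φ (ContinuousLinearMap.id ℂ K) = ContinuousLinearMap.id ℂ H) : IsNormalChannel Φ :=
  ⟨h.isCompletelyPositive, h1, h.isNormalMap⟩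

end Kraus

/-! ### Choi states -/

section ChoiState

variable {H : Type u} {K : Type v} [NormedAddCommGroup H] [InnerProductSpace ℂ H] [CompleteSpace H]
  [NormedAddCommGroup K] [InnerProductSpace ℂ K] [CompleteSpace K] {L : Type*}
  {ρ₀ : H →L[ℂ] H} {Ω : HilbertTensor H H}

/-- Faithfulness of `ρ₀` makes the slices of `Ω♭` dense: if `z` is orthogonal to all of them, then
`|z⟩⟨z| ⊗ 1` annihilates `Ω`, so the state vanishes on `|z⟩⟨z|`. -/
theorem IsMinimalGNSVector.denseRange_sliceDual (hρ₀ : IsFaithfulState ρ₀)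
    (hΩ : IsMinimalGNSVector ρ₀ Ω) : DenseRange (sliceDual (swap Ω)) := by
  have hbot : (LinearMap.range (sliceDual (swap Ω)))ᗮ = ⊥ := by
    refine (Submodule.eq_bot_iff _).2 fun z hz => ?_
    have hz' : ∀ y, ⟪z, slice y (swap Ω)⟫_ℂ = 0 := fun y => by
      have := (Submodule.mem_orthogonal' _ z).1 hz _ ⟨InnerProductSpace.toDual ℂ H y, rfl⟩
      simpa [sliceDual] using this
    have hslice : slice z Ω = 0 := ext_inner_left ℂ fun y => by
      rw [inner_slice, ← swap_tmul, inner_swap_left, ← inner_slice, hz', inner_zero_right]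
    have htr := hΩ.1 (InnerProductSpace.rankOne ℂ z z)
    rw [inner_opTensor_rankOne, hslice, inner_zero_left] at htr
    simpa using hρ₀.2 _ (InnerProductSpace.isPositive_rankOne_self z) htr
  have := Submodule.topologicalClosure_eq_top_iff.2 hbot
  rwa [← Submodule.dense_iff_topologicalClosure_eq_top] at this

theorem sliceDual_toDual (ξ : HilbertTensor H K) (x : H) :
    sliceDual ξ (InnerProductSpace.toDual ℂ H x) = slice x ξ := by
  simp [sliceDual]

/-- A GNS vector is a unit vector. -/
theorem inner_self_of_isMinimalGNSVector (hρ₀ : IsDensityOperator ρ₀)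
    (hΩ : IsMinimalGNSVector ρ₀ Ω) : ⟪Ω, Ω⟫_ℂ = 1 := by
  have := hΩ.1 (.id ℂ H)
  rw [opTensor_id_id] at this
  exact this.unique hρ₀.2

/-- Slices of `Ω♭` being dense, an operator is determined by the functional
`A' ↦ ⟪Ω, (D ⊗ A') Ω⟫`. -/
theorem eq_of_inner_opTensor_eq (hd : DenseRange (sliceDual (swap Ω))) {D D' : H →L[ℂ] H}
    (h : ∀ A', ⟪Ω, opTensor D A' Ω⟫_ℂ = ⟪Ω, opTensor D' A' Ω⟫_ℂ) : D = D' := by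
  have hslice : ∀ φ ψ, ⟪sliceDual (swap Ω) φ, D (sliceDual (swap Ω) ψ)⟫_ℂ =
      ⟪sliceDual (swap Ω) φ, D' (sliceDual (swap Ω) ψ)⟫_ℂ := fun φ ψ => by
    obtain ⟨x, rfl⟩ := (InnerProductSpace.toDual ℂ H).surjective φ
    obtain ⟨y, rfl⟩ := (InnerProductSpace.toDual ℂ H).surjective ψ
    have := h (InnerProductSpace.rankOne ℂ x y)
    rw [← inner_swap_opTensor_swap Ω _ D, ← inner_swap_opTensor_swap Ω _ D',
      inner_opTensor_rankOne, inner_opTensor_rankOne] at this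
    simpa only [sliceDual_toDual] using this
  have hD : ⇑D = ⇑D' := hd.equalizer D.continuous D'.continuous <| funext fun ψ =>
    hd.eq_of_inner_right (𝕜 := ℂ) fun φ => hslice φ ψ
  exact DFunLike.coe_injective hD

omit [CompleteSpace K] in
theorem IsChoiState.channel_unique (hd : DenseRange (sliceDual (swap Ω)))
    {Φ Φ' : (K →L[ℂ] K) →ₗ[ℂ] (H →L[ℂ] H)}
    {S : HilbertTensor H K →L[ℂ] HilbertTensor H K} (h : IsChoiState Ω Φ S)
    (h' : IsChoiState Ω Φ' S) : Φ = Φ' :=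
  LinearMap.ext fun B => eq_of_inner_opTensor_eq hd fun A' => (h.2 A' B).unique (h'.2 A' B)

omit [CompleteSpace H] [CompleteSpace K] in
/-- The traces `tr(S (|x⟩⟨x'| ⊗ |y⟩⟨y'|))` are the matrix elements of `S`. -/
theorem IsChoiState.unique {Φ : (K →L[ℂ] K) →ₗ[ℂ] (H →L[ℂ] H)}
    {S S' : HilbertTensor H K →L[ℂ] HilbertTensor H K} (h : IsChoiState Ω Φ S)
    (h' : IsChoiState Ω Φ S') : S = S' := by
  refine clm_ext_tmul fun x y => ext_inner_tmul fun x' y' => ?_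
  have h1 := h.2 (InnerProductSpace.rankOne ℂ x x') (InnerProductSpace.rankOne ℂ y y')
  have h2 := h'.2 (InnerProductSpace.rankOne ℂ x x') (InnerProductSpace.rankOne ℂ y y')
  rw [opTensor_rankOne_rankOne] at h1 h2
  rw [(hasTrace_comp_rankOne S _ _).unique h1, (hasTrace_comp_rankOne S' _ _).unique h2]

/-- The orthogonality of Kraus operators with respect to `ρ₀` is that of the vectors
`(1 ⊗ A) Ω♭`. -/
theorem hasTrace_adjoint_comp (hΩ : IsMinimalGNSVector ρ₀ Ω) (A B : H →L[ℂ] K) :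
    HasTrace (ρ₀ ∘L A† ∘L B) ⟪opTensor (.id ℂ H) A (swap Ω), opTensor (.id ℂ H) B (swap Ω)⟫_ℂ := by
  have := hΩ.1 (A† ∘L B)
  rw [← inner_swap_opTensor_swap] at this
  rwa [← ContinuousLinearMap.adjoint_inner_right, adjoint_opTensor, opTensor_opTensor,
    ContinuousLinearMap.adjoint_id]

theorem IsKrausDecomposition.hasSum_inner_opTensor {Φ : (K →L[ℂ] K) →ₗ[ℂ] (H →L[ℂ] H)}
    {V : L → H →L[ℂ] K} (hV : IsKrausDecomposition Φ V) {w : L → HilbertTensor H K}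
    (hw : ∀ l, w l = opTensor (.id ℂ H) (V l) (swap Ω)) (A' : H →L[ℂ] H) (B : K →L[ℂ] K) :
    HasSum (fun l => ⟪w l, opTensor A' B (w l)⟫_ℂ) ⟪Ω, opTensor (Φ B) A' Ω⟫_ℂ := by
  refine (hasSum_congr_iff fun l => ?_).1 ((hV B).opTensor_right A' Ω Ω)
  rw [hw, ← ContinuousLinearMap.adjoint_inner_right, adjoint_opTensor, opTensor_opTensor,
    opTensor_opTensor, inner_swap_opTensor_swap, ContinuousLinearMap.adjoint_id]
  rfl

theorem IsKrausDecomposition.summable_sq_norm_choi {Φ : (K →L[ℂ] K) →ₗ[ℂ] (H →L[ℂ] H)}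
    {V : L → H →L[ℂ] K} (hV : IsKrausDecomposition Φ V) {w : L → HilbertTensor H K}
    (hw : ∀ l, w l = opTensor (.id ℂ H) (V l) (swap Ω)) : Summable fun l => ‖w l‖ ^ 2 := by
  have := (hV.hasSum_inner_opTensor hw (.id ℂ H) (.id ℂ K)).summable
  refine Complex.summable_ofReal.1 (this.congr fun l => ?_)
  simp [inner_self_eq_norm_sq_to_K]

/-- The operator `∑ |w l⟩⟨w l|` built from any Kraus decomposition is the Choi state; orthogonality of
the `w l` plays no role. -/
theorem IsKrausDecomposition.isChoiState (hρ₀ : IsDensityOperator ρ₀)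
    (hΩ : IsMinimalGNSVector ρ₀ Ω) {Φ : (K →L[ℂ] K) →ₗ[ℂ] (H →L[ℂ] H)}
    (h1 : Φ (ContinuousLinearMap.id ℂ K) = ContinuousLinearMap.id ℂ H)
    {V : L → H →L[ℂ] K} (hV : IsKrausDecomposition Φ V) {w : L → HilbertTensor H K}
    (hw : ∀ l, w l = opTensor (.id ℂ H) (V l) (swap Ω))
    {S : HilbertTensor H K →L[ℂ] HilbertTensor H K}
    (hS : HasWeakSum (fun l => ketBra (w l)) S) : IsChoiState Ω Φ S := by
  have htr : ∀ (A' : H →L[ℂ] H) (B : K →L[ℂ] K),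
      HasTrace (S ∘L opTensor A' B) ⟪Ω, opTensor (Φ B) A' Ω⟫_ℂ := fun A' B =>
    hasTrace_comp_of_hasWeakSum hS (hV.summable_sq_norm_choi hw) _
      (hV.hasSum_inner_opTensor hw A' B)
  refine ⟨⟨isPositive_of_hasWeakSum_ketBra hS, ?_⟩, htr⟩
  have := htr (.id ℂ H) (.id ℂ K)
  rwa [h1, opTensor_id_id, opTensor_id_id, ContinuousLinearMap.comp_id,
    ContinuousLinearMap.id_apply, inner_self_of_isMinimalGNSVector hρ₀ hΩ] at this

/-- The heart of the inverse construction. The margin condition reads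
`∑ ‖slice x (w l)‖² = ‖slice x Ω♭‖²`, so that `slice x Ω♭ ↦ slice x (w l)` is a contraction defined
on a dense subspace; its extension `V l` satisfies `(1 ⊗ V l) Ω♭ = w l`. -/
theorem exists_kraus_of_hasFirstMargin (hd : DenseRange (sliceDual (swap Ω)))
    {S : HilbertTensor H K →L[ℂ] HilbertTensor H K} (hSd : IsDensityOperator S)
    (hSm : HasFirstMargin S (commutantState Ω)) {w : L → HilbertTensor H K}
    (hS : HasWeakSum (fun l => ketBra (w l)) S) :
    ∃ (Φ : (K →L[ℂ] K) →ₗ[ℂ] (H →L[ℂ] H)) (V : L → H →L[ℂ] K), IsKrausDecomposition Φ V ∧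
      Φ (ContinuousLinearMap.id ℂ K) = ContinuousLinearMap.id ℂ H ∧
      ∀ l, w l = opTensor (.id ℂ H) (V l) (swap Ω) := by
  have hw := summable_of_hasWeakSum_hasTrace hS hSd.2
  -- The margin condition, evaluated at `|x⟩⟨x|`.
  have hmargin : ∀ x, HasSum (fun l => ‖slice x (w l)‖ ^ 2) (‖slice x (swap Ω)‖ ^ 2) := fun x => by
    have hsum : Summable fun l => ‖slice x (w l)‖ ^ 2 := summable_sq_norm_clm (slice x) hw
    have hval : ∀ l, ((‖slice x (w l)‖ ^ 2 : ℝ) : ℂ) =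
        ⟪w l, opTensor (InnerProductSpace.rankOne ℂ x x) (.id ℂ K) (w l)⟫_ℂ := fun l => by
      rw [inner_opTensor_rankOne, ContinuousLinearMap.id_apply, inner_self_eq_norm_sq_to_K]
      simp
    have htr := hasTrace_comp_of_hasWeakSum hS hw _
      ((hasSum_congr_iff hval).1 (Complex.hasSum_ofReal.2 hsum.hasSum))
    have := htr.unique (hSm _)
    rw [commutantState, ← inner_swap_opTensor_swap, inner_opTensor_rankOne,
      ContinuousLinearMap.id_apply, inner_self_eq_norm_sq_to_K] at this
    have heq : ∑' l, ‖slice x (w l)‖ ^ 2 = ‖slice x (swap Ω)‖ ^ 2 := by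
      refine Complex.ofReal_injective (this.trans ?_)
      simp
    exact heq ▸ hsum.hasSum
  have hdual : ∀ φ, HasSum (fun l => ‖sliceDual (w l) φ‖ ^ 2) (‖sliceDual (swap Ω) φ‖ ^ 2) :=
    fun φ => hmargin _
  have hbd : ∀ l, ∃ C, ∀ φ, ‖sliceDual (w l) φ‖ ≤ C * ‖sliceDual (swap Ω) φ‖ := fun l =>
    ⟨1, fun φ => by
      rw [one_mul]
      exact le_of_sq_le_sq (le_hasSum (hdual φ) l fun _ _ => by positivity) (norm_nonneg _)⟩
  set V : L → H →L[ℂ] K := fun l => (sliceDual (w l)).extendOfNorm (sliceDual (swap Ω)) with hVdef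
  have hV : ∀ l φ, V l (sliceDual (swap Ω) φ) = sliceDual (w l) φ := fun l φ =>
    LinearMap.extendOfNorm_eq hd (hbd l) φ
  obtain ⟨Φ, hΦ⟩ := exists_isKrausDecomposition (V := V) fun F x => by
    -- For finite partial sums both sides are continuous in `x`, so the inequality extends by density.
    refine hd.induction_on x (isClosed_le (by fun_prop) (by fun_prop)) fun φ => ?_
    simp only [hV]
    exact sum_le_hasSum F (fun _ _ => by positivity) (hdual φ)
  refine ⟨Φ, V, hΦ, ?_, fun l => ext_slice fun x => ?_⟩
  · -- `Φ 1` is bounded, so `Φ 1 = 1` need only be tested on the slices of `Ω♭`.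
    have hx : ∀ x, ⟪x, Φ (.id ℂ K) x⟫_ℂ = ⟪x, x⟫_ℂ := fun x => by
      refine hd.induction_on x (isClosed_eq (by fun_prop) (by fun_prop)) fun φ => ?_
      refine (hΦ.hasSum_inner (.id ℂ K) _ _).unique ?_
      simp only [hV, ContinuousLinearMap.id_apply, inner_self_eq_norm_sq_to_K]
      exact_mod_cast Complex.hasSum_ofReal.2 (hdual φ)
    have := (ext_inner_map (Φ (.id ℂ K) : H →ₗ[ℂ] H) LinearMap.id).1 fun x => by
      rw [← inner_conj_symm, ContinuousLinearMap.coe_coe, hx, inner_conj_symm]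
      rfl
    exact ContinuousLinearMap.coe_injective this
  · rw [slice_opTensor_id, ← sliceDual_toDual, ← sliceDual_toDual, hV]

/-- Orthogonal nonzero vectors `(1 ⊗ V l) Ω♭` force the `V l` to be weakly independent: a relation
between the `V l` yields the relation `∑ α l • w l = 0`. -/
theorem IsKrausDecomposition.weaklyIndependent {Φ : (K →L[ℂ] K) →ₗ[ℂ] (H →L[ℂ] H)}
    {V : L → H →L[ℂ] K} (hV : IsKrausDecomposition Φ V) {w : L → HilbertTensor H K}
    (hw : ∀ l, w l = opTensor (.id ℂ H) (V l) (swap Ω)) (hne : ∀ l, w l ≠ 0)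
    (horth : Pairwise fun l m => ⟪w l, w m⟫_ℂ = 0) : WeaklyIndependent V := by
  refine ⟨hV.summable_sq_norm, fun α hα h0 m => ?_⟩
  have hsum : Summable fun l => α l • w l := by
    refine .of_norm_bounded (hα.add (hV.summable_sq_norm_choi hw)) fun l => ?_
    rw [norm_smul]
    nlinarith [sq_nonneg (‖α l‖ - ‖w l‖), norm_nonneg (α l), norm_nonneg (w l)]
  have hzero : ∑' l, α l • w l = 0 := ext_inner_tmul fun x y => by
    rw [inner_zero_right]
    refine (hsum.hasSum.mapL (innerSL ℂ (tmul x y))).unique ?_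
    refine (hasSum_congr_iff fun l => ?_).1 (h0 (slice x (swap Ω)) y)
    rw [innerSL_apply_apply, inner_smul_right, ← inner_slice, hw, slice_opTensor_id]
  have h1 := hsum.hasSum.mapL (innerSL ℂ (w m))
  rw [hzero, map_zero] at h1
  have h2 := h1.unique (hasSum_single m fun l hl => by
    rw [innerSL_apply_apply, inner_smul_right, horth hl.symm, mul_zero])
  rw [innerSL_apply_apply, inner_smul_right, zero_eq_mul] at h2
  exact h2.resolve_right (inner_self_ne_zero.2 (hne m))

omit [CompleteSpace H] in
theorem swap_eq_self_of_hasSum {ι : Type*} {c : ι → ℂ} {e : ι → H}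
    (h : HasSum (fun i => c i • tmul (e i) (e i)) Ω) : swap Ω = Ω := by
  have := h.mapL (swap : HilbertTensor H H →L[ℂ] HilbertTensor H H)
  simp only [map_smul, swap_tmul] at this
  exact this.unique h

end ChoiState

end Choi

theorem mainTheorem4
    {H : Type*} [NormedAddCommGroup H] [InnerProductSpace ℂ H] [CompleteSpace H]
    [TopologicalSpace.SeparableSpace H]
    {K : Type*} [NormedAddCommGroup K] [InnerProductSpace ℂ K] [CompleteSpace K]
    (ρ₀ : H →L[ℂ] H) (hρ₀ : Choi.IsFaithfulState ρ₀)
    (Ω : Choi.HilbertTensor H H) (hΩ : Choi.IsMinimalGNSVector ρ₀ Ω) :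
    -- (a)
    (∀ (Φ : (K →L[ℂ] K) →ₗ[ℂ] (H →L[ℂ] H)), Choi.IsNormalChannel Φ →
      ∀ (L : Type*) [Nonempty L] (V : L → H →L[ℂ] K), Choi.IsKrausDecomposition Φ V →
        (Pairwise fun l m => Choi.HasTrace (ρ₀ ∘L (V l)† ∘L V m) 0) →
        ∀ w : L → Choi.HilbertTensor H K,
          (∀ l, w l = Choi.opTensor (ContinuousLinearMap.id ℂ H) (V l) (Choi.swap Ω)) →
          (Pairwise fun l m => ⟪w l, w m⟫_ℂ = 0) ∧
          (∃! S, Choi.IsChoiState Ω Φ S) ∧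
          ∀ S, Choi.IsChoiState Ω Φ S → HasSum (fun l => Choi.ketBra (w l)) S) ∧
    -- (b)
    (∀ S : Choi.HilbertTensor H K →L[ℂ] Choi.HilbertTensor H K, Choi.IsDensityOperator S →
      Choi.HasFirstMargin S (Choi.commutantState Ω) →
      (∃! Φ : (K →L[ℂ] K) →ₗ[ℂ] (H →L[ℂ] H),
        Choi.IsNormalChannel Φ ∧ Choi.IsChoiState Ω Φ S) ∧
      ∀ Φ : (K →L[ℂ] K) →ₗ[ℂ] (H →L[ℂ] H), Choi.IsNormalChannel Φ → Choi.IsChoiState Ω Φ S →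
        ∀ (L : Type*) [Nonempty L] (w : L → Choi.HilbertTensor H K), (∀ l, w l ≠ 0) →
          (Pairwise fun l m => ⟪w l, w m⟫_ℂ = 0) →
          Choi.HasWeakSum (fun l => Choi.ketBra (w l)) S →
          ∃ V : L → H →L[ℂ] K, Choi.IsMinimalKraus Φ V ∧
            (Pairwise fun l m => Choi.HasTrace (ρ₀ ∘L (V l)† ∘L V m) 0) ∧
            ∀ l, w l = Choi.opTensor (ContinuousLinearMap.id ℂ H) (V l) (Choi.swap Ω)) ∧
    -- for the canonical GNS vector the swap is invisible and the commutant state is `ρ₀` itself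
    (∀ (ι : Type*) (e : HilbertBasis ι ℂ H) (t : ι → ℝ), (∀ i, ρ₀ (e i) = (t i : ℂ) • e i) →
      HasSum (fun i => ((√(t i) : ℝ) : ℂ) • Choi.tmul (e i) (e i)) Ω →
      Choi.swap Ω = Ω ∧
        ∀ A : H →L[ℂ] H, Choi.HasTrace (ρ₀ ∘L A) (Choi.commutantState Ω A)) := by
  have hd := hΩ.denseRange_sliceDual hρ₀
  refine ⟨fun Φ hΦ L _ V hV htr w hw => ?_, fun S hS hSm => ⟨?_, ?_⟩, fun ι e t _ hsum => ?_⟩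
  · have hksum := Choi.summable_ketBra (hV.summable_sq_norm_choi hw)
    have hS := hV.isChoiState hρ₀.1 hΩ hΦ.unital hw (.of_hasSum hksum.hasSum)
    refine ⟨fun l m hlm => ?_, ⟨_, hS, fun S' hS' => hS'.unique hS⟩, fun S' hS' => ?_⟩
    · dsimp only
      rw [hw, hw]
      exact (Choi.hasTrace_adjoint_comp hΩ (V l) (V m)).unique (htr hlm)
    · rw [hS'.unique hS]
      exact hksum.hasSum
  · -- Existence of `Φ` needs some decomposition of `S`, not an orthogonal one.
    obtain ⟨s, w, hw⟩ := Choi.exists_hasWeakSum_ketBra hS.1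
    obtain ⟨Φ, V, hV, h1, hVw⟩ := Choi.exists_kraus_of_hasFirstMargin hd hS hSm hw
    have hΦS := hV.isChoiState hρ₀.1 hΩ h1 hVw hw
    exact ⟨Φ, ⟨hV.isNormalChannel h1, hΦS⟩, fun Φ' hΦ' => hΦ'.2.channel_unique hd hΦS⟩
  · intro Φ _ hΦS L _ w hne horth hw
    -- The channel built from `w` has the same Choi state as `Φ`, hence is `Φ`.
    obtain ⟨Φ', V, hV, h1, hVw⟩ := Choi.exists_kraus_of_hasFirstMargin hd hS hSm hw
    obtain rfl := hΦS.channel_unique hd (hV.isChoiState hρ₀.1 hΩ h1 hVw hw)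
    refine ⟨V, ⟨hV, hV.weaklyIndependent hVw hne horth⟩, fun l m hlm => ?_, hVw⟩
    have h := Choi.hasTrace_adjoint_comp hΩ (V l) (V m)
    rwa [← hVw, ← hVw, horth hlm] at h
  · have hswap := Choi.swap_eq_self_of_hasSum hsum
    refine ⟨hswap, fun A => ?_⟩
    have h := hΩ.1 A
    rwa [← Choi.inner_swap_opTensor_swap, hswap] at h
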